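/- **Setting.** Let $J:\mathbb R\to[0,\infty)$ be an even, integrable function with compact support, and put $\hat J=\int_{\mathbb R}J(x)\,dx$. Let $\beta>0$ and $\lambda\in\mathbb R$. With the convention $0\ln 0=0$, for $m,n\ge 0$ let $$f(m,n)=m\ln m+n\ln n+\beta\hat J\,mn-\lambda m-\lambda n,\qquad g=\inf_{m,n\ge 0}f(m,n).$$ Let $0\le\rho^-<\rho^+$ be such that $(\rho^-,\rho^+)$ and $(\rho^+,\rho^-)$ both minimize $f$ on $[0,\infty)^2$. For a pair of profiles $m,n:\mathbb R\to\mathbb R$ define the excess free energy $$\mathcal G(m,n)=\int_{\mathbb R}\Big[m(x)\ln m(x)+n(x)\ln n(x)+\beta\int_{\mathbb R}J(x-y)m(x)n(y)\,dy-\lambda m(x)-\lambda n(x)-g\Big]dx .$$ Let $w_1,v_1$ be increasing with limits $\rho^-$ at $-\infty$ and $\rho^+$ at $+\infty$, and let $w_2,v_2$ be decreasing with limits $\rho^+$ at $-\infty$ and $\rho^-$ at $+\infty$. Suppose that there are probability densities $\eta_1,\eta_2,\zeta_1,\zeta_2$ on $\mathbb R$ such that for all $x$ $$w_1(x)=\rho^-+(\rho^+-\rho^-)\int_{-\infty}^x\eta_1,\qquad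 w_2(x)=\rho^++(\rho^--\rho^+)\int_{-\infty}^x\eta_2,$$ and likewise for $v_1,v_2$ with $\zeta_1,\zeta_2$. For $i=1,2$ let $T_i$ be the monotone map that pushes $\eta_i\,dx$ forward to $\zeta_i\,dx$, that is, $T_i(x)=\inf\{y:\int_{-\infty}^x\eta_i<\int_{-\infty}^y\zeta_i\}$. For $0\le t\le 1$ put $T_i^t(x)=(1-t)x+tT_i(x)$, let $\mu_i^t$ be the push-forward of $\eta_i\,dx$ under $T_i^t$, and let $$m_t(x)=\rho^-+(\rho^+-\rho^-)\,\mu_1^t((-\infty,x]),\qquad n_t(x)=\rho^++(\rho^--\rho^+)\,\mu_2^t((-\infty,x])$$ be the displacement interpolations between $(w_1,w_2)$ and $(v_1,v_2)$. **Theorem.** Suppose that $\eta_1,\eta_2,\zeta_1,\zeta_2$ have finite first moments. Then the integrals (over $x$) defining $\mathcal G(w_1,w_2)$, $\mathcal G(v_1,v_2)$ and, for $0<t<1$, $\mathcal G(m_t,n_t)$ converge absolutely, and for $0<t<1$ $$\mathcal G(m_t,n_t)\le(1-t)\,\mathcal G(w_1,w_2)+t\,\mathcal G(v_1,v_2).$$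 If moreover $J$ is strictly positive on some nonempty open interval, and $w_1'>0$ and $w_2'<0$ almost everywhere, then for each $t\in(0,1)$ equality holds if and only if $(v_1,v_2)$ is a translate of $(w_1,w_2)$, i.e. there is $a\in\mathbb R$ with $v_1(x)=w_1(x-a)$ and $v_2(x)=w_2(x-a)$ for all $x$. -/

import Mathlib

open MeasureTheory ProbabilityTheory Set Filter Topology

noncomputable section

namespace BinaryFluid

/-- Monotone increasing profiles with limits `a` at `-∞` and `b` at `+∞`. -/
def incProfiles (a b : ℝ) : Set (ℝ → ℝ) :=
  {m | Monotone m ∧ Tendsto m atBot (𝓝 a) ∧ Tendsto m atTop (𝓝 b)}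

/-- Monotone decreasing profiles with limits `a` at `-∞` and `b` at `+∞`. -/
def decProfiles (a b : ℝ) : Set (ℝ → ℝ) :=
  {m | Antitone m ∧ Tendsto m atBot (𝓝 a) ∧ Tendsto m atTop (𝓝 b)}

/-- `ρ` is a probability density on the line. -/
structure IsProbDensity (ρ : ℝ → ℝ) : Prop where
  nonneg : 0 ≤ᵐ[volume] ρ
  integrable : Integrable ρ
  integral_eq_one : ∫ x, ρ x = 1

/-- The profile `m`, running from `a` to `b`, has the probability density `ρ`:
`m(x) = a + (b - a) ∫_{-∞}^x ρ(s) ds`. -/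
structure HasDensity (a b : ℝ) (m ρ : ℝ → ℝ) : Prop where
  isProbDensity : IsProbDensity ρ
  eq : ∀ x, m x = a + (b - a) * ∫ s in Iic x, ρ s

/-- The density `ρ` has a finite first moment. -/
def FiniteFirstMoment (ρ : ℝ → ℝ) : Prop := Integrable (fun x => |x| * ρ x)

/-- The measure `ρ(x) dx`. -/
def densityMeasure (ρ : ℝ → ℝ) : Measure ℝ :=
  volume.withDensity (fun x => ENNReal.ofReal (ρ x))

/-- The monotone transport map from `μ` to `ν`: the composition of the distribution function of
`μ` with the inverse `u ↦ inf {y | u < F_ν(y)}` of the distribution function of `ν`. -/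
def monotoneMap (μ ν : Measure ℝ) (x : ℝ) : ℝ := sInf {y | cdf μ x < cdf ν y}

/-- The push-forward of `μ` under `x ↦ (1 - t) x + t T(x)`, with `T` the monotone transport map
from `μ` to `ν`. -/
def displacement (μ ν : Measure ℝ) (t : ℝ) : Measure ℝ :=
  μ.map (fun x => (1 - t) * x + t * monotoneMap μ ν x)

/-- The displacement interpolation, at time `t`, between the two profiles that run from `a` to `b`
and have the densities `ρ₀` and `ρ₁`. -/
def interpProfile (a b : ℝ) (ρ₀ ρ₁ : ℝ → ℝ) (t x : ℝ) : ℝ :=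
  a + (b - a) * (displacement (densityMeasure ρ₀) (densityMeasure ρ₁) t).real (Iic x)

/-- The total mass `Ĵ` of the interaction kernel. -/
def mass (J : ℝ → ℝ) : ℝ := ∫ x, J x

/-- The local Gibbs free energy density `f` with equal chemical potentials `lam`, as a function of
the two particle densities. -/
def localGibbs (J : ℝ → ℝ) (β lam : ℝ) (p : ℝ × ℝ) : ℝ :=
  p.1 * Real.log p.1 + p.2 * Real.log p.2 + β * mass J * p.1 * p.2 - lam * p.1 - lam * p.2

/-- The pairs of non-negative particle densities. -/
def quadrant : Set (ℝ × ℝ) := {p | 0 ≤ p.1 ∧ 0 ≤ p.2}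

/-- The infimum `g` of the local Gibbs free energy density. -/
def minGibbs (J : ℝ → ℝ) (β lam : ℝ) : ℝ := sInf (localGibbs J β lam '' quadrant)

/-- The density of the excess free energy of the pair of profiles `(m, n)`. -/
def excessDensity (J : ℝ → ℝ) (β lam : ℝ) (m n : ℝ → ℝ) (x : ℝ) : ℝ :=
  m x * Real.log (m x) + n x * Real.log (n x) + β * (∫ y, J (x - y) * m x * n y)
    - lam * m x - lam * n x - minGibbs J β lam

/-- The excess free energy `G(m, n)` of the pair of profiles `(m, n)`. -/
def excessEnergy (J : ℝ → ℝ) (β lam : ℝ) (m n : ℝ → ℝ) : ℝ :=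
  ∫ x, excessDensity J β lam m n x

/-! The map `monotoneMap` is the monotone transport map: it is monotone on a set of full measure
and carries `μ` to `ν`. -/

theorem exists_cdf_eq (μ : Measure ℝ) [IsProbabilityMeasure μ] [NullSingletonClass μ] {c : ℝ}
    (h0 : 0 < c) (h1 : c < 1) : ∃ x, cdf μ x = c := by
  have hc : Continuous (cdf μ) := by
    rw [continuous_iff_continuousAt]
    intro x
    rw [(monotone_cdf μ).continuousAt_iff_leftLim_eq_rightLim,
      StieltjesFunction.rightLim_eq]
    have h := (cdf μ).measure_singleton x
    rw [measure_cdf, measure_singleton] at h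
    have h2 := ENNReal.ofReal_eq_zero.1 h.symm
    exact le_antisymm ((monotone_cdf μ).leftLim_le le_rfl) (by linarith)
  obtain ⟨a, ha⟩ := ((tendsto_cdf_atBot μ).eventually (gt_mem_nhds h0)).exists
  obtain ⟨b, hb⟩ := ((tendsto_cdf_atTop μ).eventually (lt_mem_nhds h1)).exists
  have := mem_range_of_exists_le_of_exists_ge hc ⟨a, ha.le⟩ ⟨b, hb.le⟩
  exact this

theorem real_cdf_le (μ : Measure ℝ) [IsProbabilityMeasure μ] [NullSingletonClass μ] {c : ℝ}
    (h0 : 0 ≤ c) : μ.real {x | cdf μ x ≤ c} ≤ c := by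
  rcases le_or_gt 1 c with h1 | h1
  · exact measureReal_le_one.trans h1
  refine le_of_forall_gt_imp_ge_of_dense fun d hd => ?_
  rcases le_or_gt 1 d with h2 | h2
  · exact measureReal_le_one.trans h2
  obtain ⟨x, hx⟩ := exists_cdf_eq μ (h0.trans_lt hd) h2
  rw [← hx, cdf_eq_real]
  refine measureReal_mono fun y hy => ?_
  by_contra hxy
  have := monotone_cdf μ (not_le.1 hxy).le
  simp only [mem_ofPred_eq] at hy
  linarith

theorem le_real_cdf_lt (μ : Measure ℝ) [IsProbabilityMeasure μ] [NullSingletonClass μ] {c : ℝ}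
    (h1 : c ≤ 1) : c ≤ μ.real {x | cdf μ x < c} := by
  refine le_of_forall_lt_imp_le_of_dense fun d hd => ?_
  rcases le_or_gt d 0 with h2 | h2
  · exact h2.trans measureReal_nonneg
  obtain ⟨x, hx⟩ := exists_cdf_eq μ h2 (hd.trans_le h1)
  rw [← hx, cdf_eq_real]
  refine measureReal_mono fun y hy => ?_
  have := monotone_cdf μ (mem_Iic.1 hy)
  simp only [mem_ofPred_eq]
  linarith

theorem ae_cdf_mem_Ioo (μ : Measure ℝ) [IsProbabilityMeasure μ] [NullSingletonClass μ] :
    ∀ᵐ x ∂μ, cdf μ x ∈ Ioo (0 : ℝ) 1 := by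
  have hm : Measurable (cdf μ) := (monotone_cdf μ).measurable
  have h1 : ∀ᵐ x ∂μ, 0 < cdf μ x := by
    have := real_cdf_le μ (le_refl (0 : ℝ))
    have h := le_antisymm this measureReal_nonneg
    rw [measureReal_eq_zero_iff] at h
    simpa [ae_iff, not_lt] using h
  have h2 : ∀ᵐ x ∂μ, cdf μ x < 1 := by
    have h := le_antisymm measureReal_le_one (le_real_cdf_lt μ (le_refl (1 : ℝ)))
    have hs : MeasurableSet {x | cdf μ x < 1} := measurableSet_lt hm measurable_const
    have h' : μ {x | cdf μ x < 1} = 1 := by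
      rw [← ENNReal.toReal_eq_one_iff]
      exact h
    exact (prob_compl_eq_zero_iff hs).2 h'
  filter_upwards [h1, h2] with x hx hy using ⟨hx, hy⟩

theorem isProbabilityMeasure_densityMeasure {ρ : ℝ → ℝ} (h : IsProbDensity ρ) :
    IsProbabilityMeasure (densityMeasure ρ) := by
  refine ⟨?_⟩
  rw [densityMeasure, withDensity_apply _ MeasurableSet.univ, Measure.restrict_univ,
    ← ofReal_integral_eq_lintegral_ofReal h.integrable h.nonneg, h.integral_eq_one,
    ENNReal.ofReal_one]

theorem nullSingletonClass_densityMeasure (ρ : ℝ → ℝ) :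
    NullSingletonClass (densityMeasure ρ) :=
  ⟨fun _ => withDensity_absolutelyContinuous _ _ (measure_singleton _)⟩

theorem monotoneMap_spec (μ ν : Measure ℝ) [IsProbabilityMeasure μ] [NullSingletonClass μ]
    [IsProbabilityMeasure ν] :
    (∃ s, (∀ᵐ x ∂μ, x ∈ s) ∧ MonotoneOn (monotoneMap μ ν) s) ∧
      AEMeasurable (monotoneMap μ ν) μ ∧ μ.map (monotoneMap μ ν) = ν := by
  set s : Set ℝ := cdf μ ⁻¹' Ioo (0 : ℝ) 1 with hs
  have hms : MeasurableSet s := (monotone_cdf μ).measurable measurableSet_Ioo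
  have hae : ∀ᵐ x ∂μ, x ∈ s := ae_cdf_mem_Ioo μ
  have hne : ∀ x ∈ s, {y | cdf μ x < cdf ν y}.Nonempty := fun x hx =>
    ((tendsto_cdf_atTop ν).eventually (lt_mem_nhds hx.2)).exists
  have hbd : ∀ x ∈ s, BddBelow {y | cdf μ x < cdf ν y} := fun x hx => by
    obtain ⟨b, hb⟩ := ((tendsto_cdf_atBot ν).eventually (gt_mem_nhds hx.1)).exists
    refine ⟨b, fun y hy => ?_⟩
    by_contra hyb
    have := monotone_cdf ν (not_le.1 hyb).le
    simp only [mem_ofPred_eq] at hy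
    linarith
  have hmono : MonotoneOn (monotoneMap μ ν) s := fun x hx y hy hxy =>
    csInf_le_csInf (hbd x hx) (hne y hy) fun z hz => (monotone_cdf μ hxy).trans_lt hz
  have hmeas : AEMeasurable (monotoneMap μ ν) μ := by
    have := aemeasurable_restrict_of_monotoneOn (μ := μ) hms hmono
    rwa [Measure.restrict_eq_self_of_ae_mem hae] at this
  refine ⟨⟨s, hae, hmono⟩, hmeas, ?_⟩
  have : IsProbabilityMeasure (μ.map (monotoneMap μ ν)) := Measure.isProbabilityMeasure_map hmeas
  refine Measure.ext_of_Iic _ _ fun a => ?_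
  rw [Measure.map_apply_of_aemeasurable hmeas measurableSet_Iic]
  rw [← ENNReal.toReal_eq_toReal_iff' (measure_ne_top _ _) (measure_ne_top _ _)]
  change μ.real _ = ν.real _
  rw [← cdf_eq_real ν a]
  refine le_antisymm ?_ ?_
  · refine le_trans ?_ (real_cdf_le μ (cdf_nonneg ν a))
    refine ENNReal.toReal_mono (measure_ne_top _ _) (measure_mono_ae ?_)
    filter_upwards [hae] with x hx hxa
    change cdf μ x ≤ cdf ν a
    have hxa' : sInf {y | cdf μ x < cdf ν y} ≤ a := hxa
    have hr : Tendsto (cdf ν) (𝓝[>] a) (𝓝 (cdf ν a)) :=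
      ((cdf ν).right_continuous a).mono_left (nhdsWithin_mono _ Ioi_subset_Ici_self)
    refine ge_of_tendsto hr ?_
    filter_upwards [self_mem_nhdsWithin] with y hy
    obtain ⟨z, hz, hzy⟩ := (csInf_lt_iff (hbd x hx) (hne x hx)).1 (hxa'.trans_lt hy)
    exact (lt_of_lt_of_le hz (monotone_cdf ν hzy.le)).le
  · refine (le_real_cdf_lt μ (cdf_le_one ν a)).trans ?_
    refine ENNReal.toReal_mono (measure_ne_top _ _) (measure_mono_ae ?_)
    filter_upwards [hae] with x hx hxa
    exact csInf_le (hbd x hx) hxa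

end BinaryFluid

end

open BinaryFluid

open BinaryFluid

/-! Each profile is a distribution function, rescaled to run between its two limits, and is
described by a random variable: the identity on `μ` for the starting profile, the monotone map `T`
for the final one, and `(1 - t) id + t T` in between. The interpolation is therefore linear in the
random variables, and it is enough to write the excess energy in terms of them.

The local terms are affine. For `X` monotone on `μ`, the event `X ≤ x` is almost surely a sublevel
set of `cdf μ`. The chain rule then writes a function of the profile at `x` as an average of the
steps `1_{X ≤ x}`, with weights that depend on `cdf μ` but not on `X`. After a fixed reference step
is subtracted, integration over `x` replaces each step by minus its jump position
(`integral_comp_profile`).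

The interaction is convex. With `F` and `G` the distribution functions of `X` and `Y`, `F(x)(1 - G(x
- u))` is the probability that `X ≤ x < Y + u` for independent `X, Y`. Its integral over `x` is the
mean of `(Y + u - X)⁺ = max(X, Y + u) - X`. Since one profile increases and the other decreases,
this term has the positive coefficient `β (ρ⁺ - ρ⁻)²`; the rest of the interaction is affine
(`excessEnergy_formula`).

Equality means that for almost every `(u, p, q)` with `J u ≠ 0` the numbers `q + u - p` and `T₂ q +
u - T₁ p` do not have opposite strict signs. As `u` varies over an interval where `J > 0`, both must
change sign at the same point, so `T₁ p - p = T₂ q - q` whenever `p - q` lies in that interval.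
Chaining such pairs makes the displacement constant (`exists_translation`). -/

namespace BinaryFluid

/-! ### Step functions and the layer-cake formula -/

/-- The unit step function with jump at `c`. -/
noncomputable def unitStep (c x : ℝ) : ℝ := if c ≤ x then 1 else 0

theorem unitStep_sub_unitStep_of_le {a b : ℝ} (h : a ≤ b) (x : ℝ) :
    unitStep a x - unitStep b x = (Ico a b).indicator (fun _ => (1 : ℝ)) x := by
  simp only [unitStep, indicator, mem_Ico]
  split_ifs <;> grind

theorem integrable_unitStep_sub (a b : ℝ) :
    Integrable (fun x => unitStep a x - unitStep b x) := by
  have key : ∀ a b : ℝ, a ≤ b → Integrable (fun x => unitStep a x - unitStep b x) := by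
    intro a b h
    simp_rw [unitStep_sub_unitStep_of_le h]
    exact (integrable_indicator_iff measurableSet_Ico).2 (integrableOn_const (by simp))
  rcases le_total a b with h | h
  · exact key a b h
  · exact (key b a h).neg.congr (.of_forall fun x => by simp)

theorem integral_unitStep_sub (a b : ℝ) :
    ∫ x, (unitStep a x - unitStep b x) = b - a := by
  have key : ∀ a b : ℝ, a ≤ b → ∫ x, (unitStep a x - unitStep b x) = b - a := by
    intro a b h
    simp_rw [unitStep_sub_unitStep_of_le h]
    rw [integral_indicator measurableSet_Ico]
    simp [h]
  rcases le_total a b with h | h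
  · exact key a b h
  · rw [← neg_sub a b, ← key b a h, ← integral_neg]
    simp

theorem integral_abs_unitStep_sub (a b : ℝ) :
    ∫ x, |unitStep a x - unitStep b x| = |b - a| := by
  have key : ∀ a b : ℝ, a ≤ b → ∫ x, |unitStep a x - unitStep b x| = b - a := by
    intro a b h
    rw [← integral_unitStep_sub]
    refine integral_congr_ae (.of_forall fun x => abs_of_nonneg ?_)
    rw [unitStep_sub_unitStep_of_le h]
    exact indicator_nonneg (fun _ _ => zero_le_one) x
  rcases le_total a b with h | h
  · rw [key a b h, abs_of_nonneg (by linarith)]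
  · rw [abs_sub_comm b a, abs_of_nonneg (by linarith : 0 ≤ a - b), ← key b a h]
    simp_rw [abs_sub_comm]

theorem aestronglyMeasurable_unitStep_prod {Ω : Type*} [MeasurableSpace Ω] {P : Measure Ω}
    [SFinite P] {A : Ω → ℝ} (hA : AEMeasurable A P) :
    AEStronglyMeasurable (fun z : ℝ × Ω => unitStep (A z.2) z.1)
      ((volume : Measure ℝ).prod P) := by
  have h1 : AEMeasurable (fun z : ℝ × Ω => A z.2) ((volume : Measure ℝ).prod P) := hA.comp_snd
  have h2 : Measurable (fun p : ℝ × ℝ => unitStep p.1 p.2) :=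
    Measurable.ite (measurableSet_le measurable_fst measurable_snd) measurable_const
      measurable_const
  exact (h2.comp_aemeasurable (h1.prodMk measurable_fst.aemeasurable)).aestronglyMeasurable

/-- Layer-cake formula: averaging differences of step functions and integrating in the space
variable gives the average of the differences of the jump positions. -/
theorem integral_average_unitStep_sub {Ω : Type*} [MeasurableSpace Ω] {P : Measure Ω}
    [SFinite P] {k A B : Ω → ℝ} (hk : AEStronglyMeasurable k P) (hA : AEMeasurable A P)
    (hB : AEMeasurable B P) (hint : Integrable (fun w => k w * (B w - A w)) P) :
    Integrable (fun x => ∫ w, k w * (unitStep (A w) x - unitStep (B w) x) ∂P) ∧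
      ∫ x, ∫ w, k w * (unitStep (A w) x - unitStep (B w) x) ∂P = ∫ w, k w * (B w - A w) ∂P := by
  have hF : Integrable (fun z : ℝ × Ω => k z.2 * (unitStep (A z.2) z.1 - unitStep (B z.2) z.1))
      ((volume : Measure ℝ).prod P) := by
    have hm : AEStronglyMeasurable (fun z : ℝ × Ω =>
        k z.2 * (unitStep (A z.2) z.1 - unitStep (B z.2) z.1)) ((volume : Measure ℝ).prod P) :=
      hk.comp_snd.mul ((aestronglyMeasurable_unitStep_prod hA).sub
        (aestronglyMeasurable_unitStep_prod hB))
    rw [integrable_prod_iff' hm]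
    refine ⟨.of_forall fun w => (integrable_unitStep_sub (A w) (B w)).const_mul (k w), ?_⟩
    refine hint.norm.congr (.of_forall fun w => ?_)
    simp only [norm_mul, Real.norm_eq_abs]
    rw [integral_const_mul, integral_abs_unitStep_sub]
  refine ⟨hF.integral_prod_left, ?_⟩
  rw [integral_integral_swap (f := fun x w => k w * (unitStep (A w) x - unitStep (B w) x)) hF]
  simp_rw [integral_const_mul, integral_unitStep_sub]

/-- A random variable on `(ℝ, μ)` that is integrable and monotone on a set of full measure. -/
structure IsMonotoneRV (μ : Measure ℝ) (X : ℝ → ℝ) : Prop where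
  integrable : Integrable X μ
  monotoneOn : ∃ s, (∀ᵐ x ∂μ, x ∈ s) ∧ MonotoneOn X s

theorem map_real_Iic {μ : Measure ℝ} {X : ℝ → ℝ} (hX : AEMeasurable X μ) (x : ℝ) :
    (μ.map X).real (Iic x) = μ.real {u | X u ≤ x} := by
  rw [map_measureReal_apply_of_aemeasurable hX measurableSet_Iic]
  rfl

/-! ### Local terms: affine in a monotone random variable -/

section Entropy

variable {μ : Measure ℝ} [IsProbabilityMeasure μ] [NullSingletonClass μ] {X : ℝ → ℝ}

theorem real_cdf_le_eq {c : ℝ} (h0 : 0 ≤ c) (h1 : c ≤ 1) : μ.real {x | cdf μ x ≤ c} = c :=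
  le_antisymm (real_cdf_le μ h0) ((le_real_cdf_lt μ h1).trans
    (measureReal_mono fun x (hx : cdf μ x < c) => hx.le))

/-- The absence of atoms gives both events the same mass. Monotonicity of `X` and of `cdf μ` makes
them nested up to a null set: either some `u` has `X u ≤ x` and `cdf μ u > c`, which forces one
inclusion, or no such `u` exists, which is the other. Nested events of equal finite mass agree
almost everywhere. -/
theorem IsMonotoneRV.le_iff_cdf_le (h : IsMonotoneRV μ X) (x : ℝ) :
    ∀ᵐ u ∂μ, X u ≤ x ↔ cdf μ u ≤ (μ.map X).real (Iic x) := by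
  have hX := h.integrable.aemeasurable
  obtain ⟨s, hs, hmono⟩ := h.monotoneOn
  set c := (μ.map X).real (Iic x) with hc
  have hp : IsProbabilityMeasure (μ.map X) := Measure.isProbabilityMeasure_map hX
  have hB : μ.real {u | cdf μ u ≤ c} = c := real_cdf_le_eq measureReal_nonneg measureReal_le_one
  have hA : μ.real {u | X u ≤ x} = c := (map_real_Iic hX x).symm
  have hAB : μ {u | X u ≤ x} = μ {u | cdf μ u ≤ c} := by
    rw [← ENNReal.toReal_eq_toReal_iff' (measure_ne_top _ _) (measure_ne_top _ _)]
    exact hA.trans hB.symm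
  have hmA : NullMeasurableSet {u | X u ≤ x} μ := nullMeasurableSet_le hX aemeasurable_const
  have hmB : NullMeasurableSet {u | cdf μ u ≤ c} μ :=
    (measurableSet_le (monotone_cdf μ).measurable measurable_const).nullMeasurableSet
  have hfin : {u | X u ≤ x} =ᵐ[μ] {u | cdf μ u ≤ c} := by
    by_cases hex : ∃ u ∈ s, X u ≤ x ∧ c < cdf μ u
    · obtain ⟨u, hus, hux, huc⟩ := hex
      have hsub : {u | cdf μ u ≤ c} ≤ᵐ[μ] {u | X u ≤ x} := by
        filter_upwards [hs] with v hv hvc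
        have hvc' : cdf μ v ≤ c := hvc
        have hvu : v ≤ u := by
          by_contra hlt
          have := monotone_cdf μ (not_le.1 hlt).le
          linarith
        exact (hmono hv hus hvu).trans hux
      exact (ae_eq_of_ae_subset_of_measure_ge hsub hAB.le hmB (measure_ne_top _ _)).symm
    · push Not at hex
      have hsub : {u | X u ≤ x} ≤ᵐ[μ] {u | cdf μ u ≤ c} := by
        filter_upwards [hs] with v hv hvc
        exact hex v hv hvc
      exact ae_eq_of_ae_subset_of_measure_ge hsub hAB.ge hmA (measure_ne_top _ _)
  filter_upwards [hfin] with u hu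
  exact iff_of_eq hu

/-- The probability integral transform: without atoms, `{cdf μ ≤ c}` has mass exactly `c` for `c` in
`[0, 1]`. -/
theorem map_cdf_eq : μ.map (cdf μ) = volume.restrict (Ioc (0 : ℝ) 1) := by
  have hm : Measurable (cdf μ) := (monotone_cdf μ).measurable
  have : IsProbabilityMeasure (μ.map (cdf μ)) := Measure.isProbabilityMeasure_map hm.aemeasurable
  refine Measure.ext_of_Iic _ _ fun c => ?_
  rw [Measure.map_apply hm measurableSet_Iic, Measure.restrict_apply measurableSet_Iic,
    ← ENNReal.toReal_eq_toReal_iff' (measure_ne_top _ _)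
      ((measure_mono inter_subset_right).trans_lt measure_Ioc_lt_top).ne]
  have h1 : (volume (Iic c ∩ Ioc (0 : ℝ) 1)).toReal = max (min c 1) 0 := by
    have : Iic c ∩ Ioc (0 : ℝ) 1 = Ioc 0 (min c 1) := by
      ext y; simp only [mem_inter_iff, mem_Iic, mem_Ioc, le_min_iff]; tauto
    rw [this, Real.volume_Ioc, sub_zero, ENNReal.toReal_ofReal']
  rw [h1]
  change μ.real {x | cdf μ x ≤ c} = _
  rcases lt_or_ge c 0 with hc | hc
  · have : {x | cdf μ x ≤ c} = ∅ := by
      ext x; simpa using hc.trans_le (cdf_nonneg μ x)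
    rw [this, measureReal_empty, max_eq_right ((min_le_left _ _).trans hc.le)]
  rcases le_or_gt c 1 with hc1 | hc1
  · rw [real_cdf_le_eq hc hc1, min_eq_left hc1, max_eq_left hc]
  · have : {x | cdf μ x ≤ c} = univ := by
      ext x; simpa using (cdf_le_one μ x).trans hc1.le
    rw [this, min_eq_right hc1.le]; simp

theorem aestronglyMeasurable_map_cdf {h : ℝ → ℝ} (hh : ContinuousOn h (Icc 0 1)) :
    AEStronglyMeasurable h (μ.map (cdf μ)) := by
  rw [map_cdf_eq]
  exact (hh.mono Ioc_subset_Icc_self).aestronglyMeasurable measurableSet_Ioc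

theorem integrable_comp_cdf_mul {h : ℝ → ℝ} (hh : ContinuousOn h (Icc 0 1)) {Z : ℝ → ℝ}
    (hZ : Integrable Z μ) : Integrable (fun u => h (cdf μ u) * Z u) μ := by
  obtain ⟨C, hC⟩ := isCompact_Icc.exists_bound_of_continuousOn hh
  exact hZ.bdd_mul ((aestronglyMeasurable_map_cdf hh).comp_aemeasurable
    (monotone_cdf μ).measurable.aemeasurable)
    (.of_forall fun u => hC _ ⟨cdf_nonneg μ u, cdf_le_one μ u⟩)

theorem integral_comp_cdf_le {h : ℝ → ℝ} (hh : ContinuousOn h (Icc 0 1)) {c : ℝ} (h0 : 0 ≤ c)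
    (h1 : c ≤ 1) :
    ∫ u in {u | cdf μ u ≤ c}, h (cdf μ u) ∂μ = ∫ s in (0 : ℝ)..c, h s := by
  have hm : Measurable (cdf μ) := (monotone_cdf μ).measurable
  have hi : Iic c ∩ Ioc (0 : ℝ) 1 = Ioc 0 c := by
    ext y; simp only [mem_inter_iff, mem_Iic, mem_Ioc]
    exact ⟨fun h => ⟨h.2.1, h.1⟩, fun h => ⟨h.2, h.1, h.2.trans h1⟩⟩
  rw [intervalIntegral.integral_of_le h0, ← hi,
    ← Measure.restrict_restrict measurableSet_Iic, ← map_cdf_eq (μ := μ),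
    setIntegral_map measurableSet_Iic (aestronglyMeasurable_map_cdf hh) hm.aemeasurable]
  rfl

/-- The chain rule for a function of a profile, in terms of the random variable `X`. -/
theorem IsMonotoneRV.comp_profile_eq (hX : IsMonotoneRV μ X) {φ φ' : ℝ → ℝ} {a b : ℝ}
    (hφ : ∀ r ∈ uIcc a b, HasDerivAt φ (φ' r) r) (hφ' : ContinuousOn φ' (uIcc a b)) (x : ℝ) :
    φ (a + (b - a) * (μ.map X).real (Iic x)) =
      φ a + ∫ u, (b - a) * φ' (a + (b - a) * cdf μ u) * unitStep (X u) x ∂μ := by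
  have hp : IsProbabilityMeasure (μ.map X) :=
    Measure.isProbabilityMeasure_map hX.integrable.aemeasurable
  have hmaps : MapsTo (fun s : ℝ => a + (b - a) * s) (Icc 0 1) (uIcc a b) := by
    intro s hs
    rw [← segment_eq_uIcc]
    exact ⟨1 - s, s, by linarith [hs.2], hs.1, by ring, by simp only [smul_eq_mul]; ring⟩
  have hh : ContinuousOn (fun s => (b - a) * φ' (a + (b - a) * s)) (Icc 0 1) :=
    continuousOn_const.mul (hφ'.comp (by fun_prop) hmaps)
  set c := (μ.map X).real (Iic x) with hc
  have h0 : 0 ≤ c := measureReal_nonneg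
  have h1 : c ≤ 1 := measureReal_le_one
  have e1 : ∫ u, (b - a) * φ' (a + (b - a) * cdf μ u) * unitStep (X u) x ∂μ =
      ∫ u in {u | cdf μ u ≤ c}, (b - a) * φ' (a + (b - a) * cdf μ u) ∂μ := by
    rw [← integral_indicator (measurableSet_le (monotone_cdf μ).measurable measurable_const)]
    refine integral_congr_ae ?_
    filter_upwards [hX.le_iff_cdf_le x] with u hu
    simp only [unitStep, indicator, mem_ofPred_eq, hu, ← hc]
    split_ifs <;> simp
  rw [e1, integral_comp_cdf_le hh h0 h1]
  have hsub : uIcc 0 c ⊆ Icc (0 : ℝ) 1 := by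
    rw [uIcc_of_le h0]; exact Icc_subset_Icc_right h1
  have := intervalIntegral.integral_eq_sub_of_hasDerivAt
    (f := fun s => φ (a + (b - a) * s)) (f' := fun s => (b - a) * φ' (a + (b - a) * s))
    (a := 0) (b := c) ?_ (hh.mono hsub).intervalIntegrable
  · rw [this]; simp
  · intro s hs
    have hd : HasDerivAt (fun s : ℝ => a + (b - a) * s) (b - a) s := by
      simpa using ((hasDerivAt_id s).const_mul (b - a)).const_add a
    rw [mul_comm]
    exact (hφ _ (hmaps (hsub hs))).comp s hd

/-- The local part of the energy is an affine function of the random variable `X`. -/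
theorem IsMonotoneRV.integral_comp_profile (hX : IsMonotoneRV μ X) {φ φ' : ℝ → ℝ} {a b : ℝ}
    (hφ : ∀ r ∈ uIcc a b, HasDerivAt φ (φ' r) r) (hφ' : ContinuousOn φ' (uIcc a b)) :
    Integrable (fun u => (b - a) * φ' (a + (b - a) * cdf μ u) * X u) μ ∧
    Integrable (fun x => φ (a + (b - a) * (μ.map X).real (Iic x)) -
      (φ a + (φ b - φ a) * unitStep 0 x)) ∧
    ∫ x, (φ (a + (b - a) * (μ.map X).real (Iic x)) - (φ a + (φ b - φ a) * unitStep 0 x)) =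
      -∫ u, (b - a) * φ' (a + (b - a) * cdf μ u) * X u ∂μ := by
  have hmaps : MapsTo (fun s : ℝ => a + (b - a) * s) (Icc 0 1) (uIcc a b) := by
    intro s hs
    rw [← segment_eq_uIcc]
    exact ⟨1 - s, s, by linarith [hs.2], hs.1, by ring, by simp only [smul_eq_mul]; ring⟩
  have hh : ContinuousOn (fun s => (b - a) * φ' (a + (b - a) * s)) (Icc 0 1) :=
    continuousOn_const.mul (hφ'.comp (by fun_prop) hmaps)
  set k : ℝ → ℝ := fun u => (b - a) * φ' (a + (b - a) * cdf μ u) with hk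
  have hkX : ∀ {Z : ℝ → ℝ}, Integrable Z μ → Integrable (fun u => k u * Z u) μ :=
    fun hZ => integrable_comp_cdf_mul hh hZ
  have hki : Integrable k μ := by simpa using hkX (integrable_const (1 : ℝ))
  have hstep : ∀ x, Integrable (fun u => unitStep (X u) x) μ := fun x => by
    refine Integrable.of_bound (C := 1) (AEMeasurable.aestronglyMeasurable ?_)
      (.of_forall fun u => ?_)
    · exact (Measurable.ite (measurableSet_le measurable_id measurable_const) measurable_const
        measurable_const : Measurable (fun c => unitStep c x)).comp_aemeasurable
          hX.integrable.aemeasurable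
    · simp only [unitStep]; split_ifs <;> simp
  -- The weights `k` have total mass `φ b - φ a`. The reference step at `0` thus carries the same
  -- weights as the profile, and only differences of steps remain, which are integrable in `x`.
  have hend : φ b - φ a = ∫ u, k u ∂μ := by
    have h1 := integral_comp_cdf_le (μ := μ) hh zero_le_one le_rfl
    have h2 : {u | cdf μ u ≤ 1} = univ := by ext u; simpa using cdf_le_one μ u
    rw [h2, Measure.restrict_univ] at h1
    have h3 := intervalIntegral.integral_eq_sub_of_hasDerivAt
      (f := fun s => φ (a + (b - a) * s)) (f' := fun s => (b - a) * φ' (a + (b - a) * s))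
      (a := 0) (b := 1) ?_ (hh.mono (uIcc_of_le zero_le_one).subset).intervalIntegrable
    · rw [hk, h1, h3]; simp
    · intro s hs
      rw [uIcc_of_le zero_le_one] at hs
      have hd : HasDerivAt (fun s : ℝ => a + (b - a) * s) (b - a) s := by
        simpa using ((hasDerivAt_id s).const_mul (b - a)).const_add a
      rw [mul_comm]
      exact (hφ _ (hmaps hs)).comp s hd
  have hpt : ∀ x, φ (a + (b - a) * (μ.map X).real (Iic x)) - (φ a + (φ b - φ a) * unitStep 0 x)
      = ∫ u, k u * (unitStep (X u) x - unitStep 0 x) ∂μ := fun x => by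
    simp_rw [mul_sub]
    rw [integral_sub (hkX (hstep x)) (hki.mul_const _), integral_mul_const, ← hend,
      hX.comp_profile_eq hφ hφ' x]
    ring
  simp_rw [hpt]
  obtain ⟨h1, h2⟩ := integral_average_unitStep_sub (P := μ) (k := k) (A := X) (B := fun _ => 0)
    hki.aestronglyMeasurable hX.integrable.aemeasurable aemeasurable_const
    (by simpa using (hkX hX.integrable).neg)
  refine ⟨hkX hX.integrable, h1, ?_⟩
  rw [h2, ← integral_neg]
  simp [hk]

end Entropy

/-! ### Laws, overlap and kernel integrals -/

/-- The profile from `a` to `b` associated with the law of the random variable `X`. -/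
noncomputable def lawProfile (a b : ℝ) (μ : Measure ℝ) (X : ℝ → ℝ) (x : ℝ) : ℝ :=
  a + (b - a) * (μ.map X).real (Iic x)

/-- The derivative of the local free energy density along the segment from `a` to `b`. -/
noncomputable def entropyWeight (lam a b s : ℝ) : ℝ :=
  (b - a) * (Real.log (a + (b - a) * s) + 1 - lam)

/-- The integrand of the interaction energy of two particles with displacement `w.1`. -/
noncomputable def overlap (J X Y : ℝ → ℝ) (w : ℝ × ℝ × ℝ) : ℝ :=
  J w.1 * (max (X w.2.1) (Y w.2.2 + w.1) - X w.2.1)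

theorem measurable_unitStep_left (x : ℝ) : Measurable (fun c => unitStep c x) :=
  Measurable.ite (measurableSet_le measurable_id measurable_const) measurable_const
    measurable_const

theorem unitStep_nonneg (c x : ℝ) : 0 ≤ unitStep c x := by
  unfold unitStep; split_ifs <;> simp

theorem unitStep_le_one (c x : ℝ) : unitStep c x ≤ 1 := by
  unfold unitStep; split_ifs <;> simp

theorem unitStep_max (c d x : ℝ) : unitStep (max c d) x = unitStep c x * unitStep d x := by
  unfold unitStep; split_ifs <;> grind

theorem unitStep_add (c u x : ℝ) : unitStep (c + u) x = unitStep c (x - u) := by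
  unfold unitStep; simp only [le_sub_iff_add_le]

theorem integral_unitStep {μ : Measure ℝ} {X : ℝ → ℝ} (hX : AEMeasurable X μ) (x : ℝ) :
    ∫ u, unitStep (X u) x ∂μ = (μ.map X).real (Iic x) := by
  rw [← integral_map hX (f := fun c => unitStep c x)
    (measurable_unitStep_left x).aestronglyMeasurable]
  have : (fun c => unitStep c x) = (Iic x).indicator 1 := by
    ext c; simp [unitStep, indicator]
  rw [this, integral_indicator_one measurableSet_Iic]

theorem integrable_mul_kernel {J : ℝ → ℝ} (hJ_supp : HasCompactSupport J)
    (hJ_int : Integrable J) : Integrable (fun u => J u * u) := by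
  obtain ⟨R, hR⟩ := (hJ_supp.isCompact.isBounded).exists_norm_le
  refine (hJ_int.norm.mul_const R).mono
    (hJ_int.aestronglyMeasurable.mul measurable_id.aestronglyMeasurable) (.of_forall fun u => ?_)
  by_cases hu : u ∈ tsupport J
  · have h1 := hR u hu
    have h2 : 0 ≤ R := (norm_nonneg u).trans h1
    rw [norm_mul, norm_mul, norm_norm, Real.norm_of_nonneg h2]
    gcongr
  · simp [image_eq_zero_of_notMem_tsupport hu]

theorem convolution_swap (J : ℝ → ℝ) (ν : Measure ℝ) (Y : ℝ → ℝ) (x : ℝ) :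
    ∫ y, J (x - y) * (ν.map Y).real (Iic y) = ∫ u, J u * (ν.map Y).real (Iic (x - u)) := by
  rw [← integral_sub_left_eq_self (fun u => J u * (ν.map Y).real (Iic (x - u))) volume x]
  simp

theorem integral_add_add_sub_add {f₁ f₂ f₃ f₄ f₅ : ℝ → ℝ} (h₁ : Integrable f₁)
    (h₂ : Integrable f₂) (h₃ : Integrable f₃) (h₄ : Integrable f₄) (h₅ : Integrable f₅) :
    Integrable (fun x => f₁ x + f₂ x + f₃ x - f₄ x + f₅ x) ∧
    ∫ x, (f₁ x + f₂ x + f₃ x - f₄ x + f₅ x) =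
      (∫ x, f₁ x) + (∫ x, f₂ x) + (∫ x, f₃ x) - (∫ x, f₄ x) + ∫ x, f₅ x := by
  have h12 : Integrable (fun x => f₁ x + f₂ x) := h₁.add h₂
  have h123 : Integrable (fun x => f₁ x + f₂ x + f₃ x) := h12.add h₃
  have h1234 : Integrable (fun x => f₁ x + f₂ x + f₃ x - f₄ x) := h123.sub h₄
  refine ⟨h1234.add h₅, ?_⟩
  rw [integral_add h1234 h₅, integral_sub h123 h₄, integral_add h12 h₃, integral_add h₁ h₂]

/-! ### Interaction energy and the formula for the excess energy -/

section Interaction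

variable {J : ℝ → ℝ} {μ ν : Measure ℝ} [IsProbabilityMeasure μ] [IsProbabilityMeasure ν]
  {X Y : ℝ → ℝ}

/-- The bound `|max(X, Z) - X| ≤ |Z - X|` with `Z = Y + u` reduces this to first moments; the
compact support of `J` controls the moment `J u * u`. -/
theorem integrable_overlap (hJ_supp : HasCompactSupport J) (hJ_int : Integrable J)
    (hX : Integrable X μ) (hY : Integrable Y ν) :
    Integrable (overlap J X Y) ((volume : Measure ℝ).prod (μ.prod ν)) := by
  have i1 : Integrable (fun w : ℝ × ℝ × ℝ => J w.1 * X w.2.1)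
      ((volume : Measure ℝ).prod (μ.prod ν)) := hJ_int.mul_prod (hX.comp_fst ν)
  have i2 : Integrable (fun w : ℝ × ℝ × ℝ => J w.1 * Y w.2.2)
      ((volume : Measure ℝ).prod (μ.prod ν)) := hJ_int.mul_prod (hY.comp_snd μ)
  have i3 : Integrable (fun w : ℝ × ℝ × ℝ => J w.1 * w.1)
      ((volume : Measure ℝ).prod (μ.prod ν)) :=
    (integrable_mul_kernel hJ_supp hJ_int).comp_fst _
  have i4 : Integrable (fun w : ℝ × ℝ × ℝ => J w.1 * Y w.2.2 + J w.1 * w.1 - J w.1 * X w.2.1)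
      ((volume : Measure ℝ).prod (μ.prod ν)) := (i2.add i3).sub i1
  have hm : AEStronglyMeasurable (overlap J X Y) ((volume : Measure ℝ).prod (μ.prod ν)) := by
    have a1 : AEMeasurable (fun w : ℝ × ℝ × ℝ => X w.2.1)
      ((volume : Measure ℝ).prod (μ.prod ν)) := (hX.comp_fst ν).aemeasurable.comp_snd
    have a2 : AEMeasurable (fun w : ℝ × ℝ × ℝ => Y w.2.2)
      ((volume : Measure ℝ).prod (μ.prod ν)) := (hY.comp_snd μ).aemeasurable.comp_snd
    have a3 : AEMeasurable (fun w : ℝ × ℝ × ℝ => J w.1)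
      ((volume : Measure ℝ).prod (μ.prod ν)) := hJ_int.aemeasurable.comp_fst
    exact (a3.mul ((a1.max (a2.add measurable_fst.aemeasurable)).sub a1)).aestronglyMeasurable
  refine i4.mono hm (.of_forall fun w => ?_)
  rw [show J w.1 * Y w.2.2 + J w.1 * w.1 - J w.1 * X w.2.1 = J w.1 * (Y w.2.2 + w.1 - X w.2.1)
    by ring, overlap, norm_mul, norm_mul]
  gcongr
  rw [Real.norm_eq_abs, Real.norm_eq_abs]
  rcases le_total (X w.2.1) (Y w.2.2 + w.1) with h | h
  · rw [max_eq_right h]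
  · rw [max_eq_left h]; simp

theorem integrable_kernel_mul_cdf (hJ_int : Integrable J) (x : ℝ) :
    Integrable (fun y => J (x - y) * (ν.map Y).real (Iic y)) ∧
      Integrable (fun u => J u * (ν.map Y).real (Iic (x - u))) := by
  have hm : Measurable (fun y => (ν.map Y).real (Iic y)) := by
    refine Monotone.measurable fun c d hcd => ?_
    exact measureReal_mono (Iic_subset_Iic.2 hcd)
  have hb : ∀ y, ‖(ν.map Y).real (Iic y)‖ ≤ 1 := fun y => by
    rw [Real.norm_of_nonneg measureReal_nonneg]
    by_cases hY : AEMeasurable Y ν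
    · have := Measure.isProbabilityMeasure_map hY
      exact measureReal_le_one
    · simp [Measure.map_of_not_aemeasurable hY]
  exact ⟨(hJ_int.comp_sub_left x).mul_bdd (c := 1) hm.aestronglyMeasurable (.of_forall hb),
    hJ_int.mul_bdd (c := 1) (hm.comp (measurable_const.sub measurable_id)).aestronglyMeasurable
      (.of_forall fun u => hb (x - u))⟩

/-- The convolution of `J` with the distribution function of `Y` is an average, with weight `J u`,
of steps at `Y + u`, so the layer-cake formula applies. -/
theorem integral_convolution_sub_unitStep (hJ_supp : HasCompactSupport J)
    (hJ_int : Integrable J) (hY : Integrable Y ν) :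
    Integrable (fun x => (∫ y, J (x - y) * (ν.map Y).real (Iic y)) - mass J * unitStep 0 x) ∧
    ∫ x, ((∫ y, J (x - y) * (ν.map Y).real (Iic y)) - mass J * unitStep 0 x) =
      -(mass J * ∫ q, Y q ∂ν + ∫ u, J u * u) := by
  have i2 : Integrable (fun w : ℝ × ℝ => J w.1 * Y w.2) ((volume : Measure ℝ).prod ν) :=
    hJ_int.mul_prod hY
  have i3 : Integrable (fun w : ℝ × ℝ => J w.1 * w.1) ((volume : Measure ℝ).prod ν) :=
    (integrable_mul_kernel hJ_supp hJ_int).comp_fst _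
  have hA : AEMeasurable (fun w : ℝ × ℝ => Y w.2 + w.1) ((volume : Measure ℝ).prod ν) :=
    hY.aemeasurable.comp_snd.add measurable_fst.aemeasurable
  have hJ1 : Integrable (fun w : ℝ × ℝ => J w.1) ((volume : Measure ℝ).prod ν) :=
    hJ_int.comp_fst _
  have hst : ∀ x, Integrable (fun w : ℝ × ℝ => J w.1 * unitStep (Y w.2 + w.1) x)
      ((volume : Measure ℝ).prod ν) := fun x => by
    refine hJ1.mul_bdd (c := 1)
      ((measurable_unitStep_left x).comp_aemeasurable hA).aestronglyMeasurable
      (.of_forall fun w => ?_)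
    rw [Real.norm_of_nonneg (unitStep_nonneg _ _)]
    exact unitStep_le_one _ _
  have hpt : ∀ x, (∫ y, J (x - y) * (ν.map Y).real (Iic y)) - mass J * unitStep 0 x =
      ∫ w : ℝ × ℝ, J w.1 * (unitStep (Y w.2 + w.1) x - unitStep 0 x)
        ∂((volume : Measure ℝ).prod ν) := fun x => by
    simp_rw [mul_sub]
    rw [integral_sub (hst x) (hJ1.mul_const _), integral_mul_const, integral_prod _ (hst x),
      integral_prod _ hJ1, convolution_swap]
    simp only [unitStep_add, integral_const_mul, integral_unitStep hY.aemeasurable,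
      integral_const, probReal_univ, one_smul, mass]
  simp_rw [hpt]
  have i5 : Integrable (fun w : ℝ × ℝ => J w.1 * (0 - (Y w.2 + w.1)))
      ((volume : Measure ℝ).prod ν) :=
    (i2.add i3).neg.congr (.of_forall fun w => by simp; ring)
  obtain ⟨h1, h2⟩ := integral_average_unitStep_sub hJ1.aestronglyMeasurable hA
    (aemeasurable_const (b := (0 : ℝ))) i5
  refine ⟨h1, ?_⟩
  have e : ∫ w : ℝ × ℝ, J w.1 * w.1 ∂((volume : Measure ℝ).prod ν) = ∫ u, J u * u := by
    rw [integral_prod _ i3]; simp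
  rw [h2, mass, ← integral_prod_mul, ← e, ← integral_add i2 i3, ← integral_neg]
  exact integral_congr_ae (.of_forall fun w => by dsimp only; ring)

/-- With weight `J u`, the integrand averages the indicator of `X ≤ x < Y + u`, the difference of
the steps at `X` and at `max(X, Y + u)`. The length of that set of `x` is `max(X, Y + u) - X`. -/
theorem integral_cdf_mul_convolution (hJ_supp : HasCompactSupport J)
    (hJ_int : Integrable J) (hX : Integrable X μ) (hY : Integrable Y ν) :
    Integrable (fun x => (μ.map X).real (Iic x) *
      (mass J - ∫ y, J (x - y) * (ν.map Y).real (Iic y))) ∧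
    ∫ x, (μ.map X).real (Iic x) * (mass J - ∫ y, J (x - y) * (ν.map Y).real (Iic y)) =
      ∫ w, overlap J X Y w ∂((volume : Measure ℝ).prod (μ.prod ν)) := by
  have hJ1 : Integrable (fun w : ℝ × ℝ × ℝ => J w.1) ((volume : Measure ℝ).prod (μ.prod ν)) :=
    hJ_int.comp_fst _
  have hA : AEMeasurable (fun w : ℝ × ℝ × ℝ => X w.2.1)
      ((volume : Measure ℝ).prod (μ.prod ν)) := (hX.comp_fst ν).aemeasurable.comp_snd
  have hB : AEMeasurable (fun w : ℝ × ℝ × ℝ => max (X w.2.1) (Y w.2.2 + w.1))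
      ((volume : Measure ℝ).prod (μ.prod ν)) :=
    hA.max ((hY.comp_snd μ).aemeasurable.comp_snd.add measurable_fst.aemeasurable)
  have hst : ∀ x, Integrable (fun w : ℝ × ℝ × ℝ => J w.1 * (unitStep (X w.2.1) x -
      unitStep (max (X w.2.1) (Y w.2.2 + w.1)) x))
      ((volume : Measure ℝ).prod (μ.prod ν)) := fun x => by
    refine hJ1.mul_bdd (c := 1) (((measurable_unitStep_left x).comp_aemeasurable hA).sub
      ((measurable_unitStep_left x).comp_aemeasurable hB)).aestronglyMeasurable
      (.of_forall fun w => ?_)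
    rw [Real.norm_eq_abs, abs_le]
    constructor <;> linarith [unitStep_nonneg (X w.2.1) x, unitStep_le_one (X w.2.1) x,
      unitStep_nonneg (max (X w.2.1) (Y w.2.2 + w.1)) x,
      unitStep_le_one (max (X w.2.1) (Y w.2.2 + w.1)) x]
  have hYst : ∀ x, Integrable (fun q => unitStep (Y q) x) ν := fun x => by
    refine Integrable.of_bound (C := 1) ((measurable_unitStep_left x).comp_aemeasurable
      hY.aemeasurable).aestronglyMeasurable (.of_forall fun q => ?_)
    rw [Real.norm_of_nonneg (unitStep_nonneg _ _)]
    exact unitStep_le_one _ _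
  have hpt : ∀ x, (μ.map X).real (Iic x) *
      (mass J - ∫ y, J (x - y) * (ν.map Y).real (Iic y)) =
      ∫ w : ℝ × ℝ × ℝ, J w.1 * (unitStep (X w.2.1) x -
        unitStep (max (X w.2.1) (Y w.2.2 + w.1)) x) ∂((volume : Measure ℝ).prod (μ.prod ν)) := by
    intro x
    have hin : ∀ u, ∫ z : ℝ × ℝ, J u * (unitStep (X z.1) x - unitStep (max (X z.1) (Y z.2 + u)) x)
        ∂(μ.prod ν) =
        (μ.map X).real (Iic x) * (J u - J u * (ν.map Y).real (Iic (x - u))) := fun u => by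
      rw [integral_const_mul]
      have : ∀ z : ℝ × ℝ, unitStep (X z.1) x - unitStep (max (X z.1) (Y z.2 + u)) x =
          unitStep (X z.1) x * (1 - unitStep (Y z.2) (x - u)) := fun z => by
        rw [unitStep_max, unitStep_add]; ring
      simp_rw [this]
      rw [integral_prod_mul (fun p => unitStep (X p) x) (fun q => 1 - unitStep (Y q) (x - u)),
        integral_sub (integrable_const _) (hYst _), integral_unitStep hX.aemeasurable,
        integral_unitStep hY.aemeasurable]
      simp
      ring
    rw [integral_prod _ (hst x)]
    simp_rw [hin]
    rw [integral_const_mul, integral_sub hJ_int (integrable_kernel_mul_cdf hJ_int x).2,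
      convolution_swap, mass]
  simp_rw [hpt]
  exact integral_average_unitStep_sub hJ1.aestronglyMeasurable hA hB
    (integrable_overlap hJ_supp hJ_int hX hY)

variable [NullSingletonClass μ] [NullSingletonClass ν]

/-- The excess free energy of a pair of profiles is an affine function of the pair of random
variables plus the convex overlap energy. -/
theorem excessEnergy_formula (hJ_supp : HasCompactSupport J)
    (hJ_int : Integrable J) {β lam a b : ℝ} (ha : 0 < a) (hab : a < b)
    (hg : minGibbs J β lam = localGibbs J β lam (a, b))
    (hX : IsMonotoneRV μ X) (hY : IsMonotoneRV ν Y) :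
    Integrable (fun u => entropyWeight lam a b (cdf μ u) * X u) μ ∧
    Integrable (fun u => entropyWeight lam b a (cdf ν u) * Y u) ν ∧
    Integrable (excessDensity J β lam (lawProfile a b μ X) (lawProfile b a ν Y)) ∧
    excessEnergy J β lam (lawProfile a b μ X) (lawProfile b a ν Y) =
      -∫ u, entropyWeight lam a b (cdf μ u) * X u ∂μ
      - ∫ u, entropyWeight lam b a (cdf ν u) * Y u ∂ν
      + β * a * (b - a) * (mass J * (∫ u, Y u ∂ν - ∫ u, X u ∂μ) + ∫ u, J u * u)
      + β * (b - a) ^ 2 * ∫ w, overlap J X Y w ∂((volume : Measure ℝ).prod (μ.prod ν)) := by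
  set φ : ℝ → ℝ := fun r => r * Real.log r - lam * r with hφdef
  have hpos : ∀ r ∈ uIcc a b, r ≠ 0 := fun r hr => by
    rw [uIcc_of_le hab.le] at hr; exact (ha.trans_le hr.1).ne'
  have hφ : ∀ r ∈ uIcc a b, HasDerivAt φ (Real.log r + 1 - lam) r := fun r hr => by
    have h := (Real.hasDerivAt_mul_log (hpos r hr)).sub ((hasDerivAt_id r).const_mul lam)
    rw [mul_one] at h
    exact h
  have hφ' : ContinuousOn (fun r => Real.log r + 1 - lam) (uIcc a b) :=
    ((Real.continuousOn_log.mono fun r hr => hpos r hr).add continuousOn_const).sub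
      continuousOn_const
  obtain ⟨p1, p2, p3⟩ := hX.integral_comp_profile hφ hφ'
  obtain ⟨q1, q2, q3⟩ := hY.integral_comp_profile (a := b) (b := a)
    (by rwa [uIcc_comm]) (by rwa [uIcc_comm])
  -- The case `φ = id` on `[0, 1]` says that the distribution function minus the step at `0`
  -- integrates to `-E X`.
  obtain ⟨-, r2, r3⟩ := hX.integral_comp_profile (a := 0) (b := 1) (φ := id) (φ' := fun _ => 1)
    (fun r _ => hasDerivAt_id r) continuousOn_const
  simp only [sub_zero, zero_add, one_mul, id] at r2 r3
  obtain ⟨s2, s3⟩ := integral_convolution_sub_unitStep hJ_supp hJ_int hY.integrable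
  obtain ⟨t2, t3⟩ := integral_cdf_mul_convolution hJ_supp hJ_int hX.integrable hY.integrable
  refine ⟨p1, q1, ?_⟩
  -- Expanding the product of the two profiles leaves `F (Ĵ - J * G)` as the only nonlinear
  -- interaction term. The constants cancel against `g = f(a, b)`, and the reference steps of the
  -- two local terms cancel each other because the profiles have opposite endpoints.
  have hexp : excessDensity J β lam (lawProfile a b μ X) (lawProfile b a ν Y) = fun x =>
      (φ (a + (b - a) * (μ.map X).real (Iic x)) - (φ a + (φ b - φ a) * unitStep 0 x))
      + (φ (b + (a - b) * (ν.map Y).real (Iic x)) - (φ b + (φ a - φ b) * unitStep 0 x))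
      + β * a * (b - a) * mass J * ((μ.map X).real (Iic x) - unitStep 0 x)
      - β * a * (b - a) *
        ((∫ y, J (x - y) * (ν.map Y).real (Iic y)) - mass J * unitStep 0 x)
      + β * (b - a) ^ 2 * ((μ.map X).real (Iic x) *
        (mass J - ∫ y, J (x - y) * (ν.map Y).real (Iic y))) := by
    funext x
    have hint : ∫ y, J (x - y) * lawProfile a b μ X x * lawProfile b a ν Y y =
        lawProfile a b μ X x *
          (b * mass J + (a - b) * ∫ y, J (x - y) * (ν.map Y).real (Iic y)) := by
      have : ∀ y, J (x - y) * lawProfile a b μ X x * lawProfile b a ν Y y =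
          lawProfile a b μ X x * (b * J (x - y) + (a - b) *
            (J (x - y) * (ν.map Y).real (Iic y))) := fun y => by
        simp only [lawProfile]; ring
      simp_rw [this]
      rw [integral_const_mul, integral_add ((hJ_int.comp_sub_left x).const_mul b)
        ((integrable_kernel_mul_cdf hJ_int x).1.const_mul _), integral_const_mul,
        integral_const_mul, integral_sub_left_eq_self J volume x, mass]
    rw [excessDensity, hint, hg]
    simp only [localGibbs, lawProfile, hφdef]
    ring
  have i3 := r2.const_mul (β * a * (b - a) * mass J)
  have i4 := s2.const_mul (β * a * (b - a))
  have i5 := t2.const_mul (β * (b - a) ^ 2)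
  simp only [excessEnergy, hexp]
  obtain ⟨h1, h2⟩ := integral_add_add_sub_add p2 q2 i3 i4 i5
  refine ⟨h1, ?_⟩
  rw [h2, integral_const_mul, integral_const_mul, integral_const_mul, p3, q3, r3, s3, t3]
  simp only [entropyWeight]
  ring

end Interaction

/-! ### Minimizers of the local free energy -/

section Minimizers

variable {J : ℝ → ℝ} {β lam ρm ρp : ℝ}

/-- The slope of `x log x` at the origin prevents minimizers on the boundary. -/
theorem pos_of_isMinOn (hρm : 0 ≤ ρm) (hρp : 0 ≤ ρp)
    (hmin : IsMinOn (localGibbs J β lam) quadrant (ρm, ρp)) : 0 < ρm := by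
  refine lt_of_le_of_ne hρm fun h0 => ?_
  subst h0
  -- Moving from `0` to `exp L` changes the energy by `exp L * (L + β Ĵ ρp - lam)`. This `L` makes
  -- the bracket `-1`, which contradicts minimality.
  set L := lam - β * mass J * ρp - 1 with hL
  have h := isMinOn_iff.1 hmin (Real.exp L, ρp) ⟨(Real.exp_pos L).le, hρp⟩
  simp only [localGibbs, Real.log_exp] at h
  have h2 : Real.exp L * (L + β * mass J * ρp - lam) = -Real.exp L := by rw [hL]; ring
  have h3 := Real.exp_pos L
  simp only [zero_mul, mul_zero, zero_add, sub_zero] at h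
  nlinarith

theorem minGibbs_eq (hρm : 0 ≤ ρm) (hρp : 0 ≤ ρp)
    (hmin : IsMinOn (localGibbs J β lam) quadrant (ρm, ρp)) :
    minGibbs J β lam = localGibbs J β lam (ρm, ρp) := by
  have hmem : (ρm, ρp) ∈ quadrant := ⟨hρm, hρp⟩
  exact IsLeast.csInf_eq ⟨mem_image_of_mem _ hmem, by
    rintro _ ⟨p, hp, rfl⟩; exact isMinOn_iff.1 hmin p hp⟩

end Minimizers

/-! ### Profiles with densities and the monotone map -/

section Density

variable {a b : ℝ} {w η ζ : ℝ → ℝ}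

theorem setIntegral_eq_densityMeasure (h : IsProbDensity η) (x : ℝ) :
    ∫ s in Iic x, η s = (densityMeasure η).real (Iic x) := by
  rw [densityMeasure, measureReal_def, withDensity_apply _ measurableSet_Iic,
    integral_eq_lintegral_of_nonneg_ae (ae_restrict_of_ae h.nonneg)
      h.integrable.aestronglyMeasurable.restrict]

theorem HasDensity.eq_lawProfile (h : HasDensity a b w η) :
    w = lawProfile a b (densityMeasure η) id := by
  funext x
  rw [h.eq, setIntegral_eq_densityMeasure h.isProbDensity, lawProfile, Measure.map_id]

theorem integrable_id_densityMeasure (h : IsProbDensity η) (hm : FiniteFirstMoment η) :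
    Integrable id (densityMeasure η) := by
  have hae : AEMeasurable (fun x => ENNReal.ofReal (η x)) :=
    h.integrable.aemeasurable.ennreal_ofReal
  rw [densityMeasure, integrable_withDensity_iff_integrable_smul₀' hae
    (.of_forall fun x => ENNReal.ofReal_lt_top)]
  refine Integrable.mono hm ?_ ?_
  · exact (hae.ennreal_toReal.smul measurable_id.aemeasurable).aestronglyMeasurable
  · filter_upwards [h.nonneg] with x hx
    rw [ENNReal.toReal_ofReal hx, norm_smul, norm_mul, mul_comm]
    simp

/-- By Lebesgue differentiation `w' = (b - a) η` almost everywhere, so a derivative that is almost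
nowhere zero forces `η > 0` almost everywhere. -/
theorem volume_absolutelyContinuous_densityMeasure (h : HasDensity a b w η)
    (hw : ∀ᵐ x, deriv w x ≠ 0) : (volume : Measure ℝ) ≪ densityMeasure η := by
  have hi := h.isProbDensity.integrable
  refine withDensity_absolutelyContinuous' hi.aemeasurable.ennreal_ofReal ?_
  filter_upwards [hw, LocallyIntegrable.ae_hasDerivAt_integral hi.locallyIntegrable, h.isProbDensity.nonneg]
    with x hx hd hnn h0
  have h0' : η x = 0 := le_antisymm (ENNReal.ofReal_eq_zero.1 h0) hnn
  have hwx : w = fun x => a + (b - a) * ((∫ s in Iic 0, η s) + ∫ s in (0 : ℝ)..x, η s) := by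
    funext y
    rw [h.eq, intervalIntegral.integral_Iic_sub_Iic hi.integrableOn hi.integrableOn |>.symm]
    ring
  have := (((hd 0).const_add (∫ s in Iic 0, η s)).const_mul (b - a)).const_add a
  rw [← hwx, h0', mul_zero] at this
  exact hx this.deriv

variable {μ ν : Measure ℝ}

theorem isMonotoneRV_id (hμ : Integrable id μ) : IsMonotoneRV μ id :=
  ⟨hμ, univ, by simp, monotone_id.monotoneOn _⟩

theorem IsMonotoneRV.interp {X : ℝ → ℝ} (h0 : Integrable id μ) (hX : IsMonotoneRV μ X) {t : ℝ}
    (ht0 : 0 ≤ t) (ht1 : t ≤ 1) : IsMonotoneRV μ (fun x => (1 - t) * x + t * X x) := by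
  obtain ⟨s, hs, hmono⟩ := hX.monotoneOn
  refine ⟨(h0.const_mul (1 - t)).add (hX.integrable.const_mul t), s, hs, fun x hx y hy hxy => ?_⟩
  have h1 : 0 ≤ 1 - t := by linarith
  have := hmono hx hy hxy
  dsimp only
  gcongr

theorem lawProfile_translate {X : ℝ → ℝ} {r : ℝ} (hX : ∀ᵐ x ∂μ, X x = x + r) (a b x : ℝ) :
    lawProfile a b μ X x = lawProfile a b μ id (x - r) := by
  rw [lawProfile, lawProfile, Measure.map_congr hX, Measure.map_id,
    map_real_Iic (measurable_id'.add_const r).aemeasurable]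
  congr 3
  ext u
  simp [le_sub_iff_add_le]

variable [IsProbabilityMeasure μ]

theorem strictMono_cdf (hμ : (volume : Measure ℝ) ≪ μ) : StrictMono (cdf μ) := by
  intro x y hxy
  have hne : μ (Ioc x y) ≠ 0 := fun h => by
    have := hμ h
    rw [Real.volume_Ioc, ENNReal.ofReal_eq_zero] at this
    linarith
  have h1 := (cdf μ).measure_Ioc x y
  rw [measure_cdf] at h1
  rw [h1, ne_eq, ENNReal.ofReal_eq_zero] at hne
  linarith

variable [IsProbabilityMeasure ν]

/-- Strict monotonicity of `cdf μ` turns the set in the definition of the map into the ray above `x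
+ r`. The formula therefore holds at every point. -/
theorem monotoneMap_translate (hμ : (volume : Measure ℝ) ≪ μ) (hab : a ≠ b) {r : ℝ}
    (h : ∀ x, lawProfile a b ν id x = lawProfile a b μ id (x - r)) (x : ℝ) :
    monotoneMap μ ν x = x + r := by
  have hcdf : ∀ y, cdf ν y = cdf μ (y - r) := fun y => by
    have h1 := h y
    simp only [lawProfile, Measure.map_id, add_right_inj] at h1
    rw [cdf_eq_real, cdf_eq_real]
    exact mul_left_cancel₀ (sub_ne_zero.2 hab.symm) h1
  have : {y | cdf μ x < cdf ν y} = Ioi (x + r) := by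
    ext y
    simp only [mem_ofPred_eq, hcdf, (strictMono_cdf hμ).lt_iff_lt, mem_Ioi, lt_sub_iff_add_lt]
  rw [monotoneMap, this, csInf_Ioi]

variable [NullSingletonClass μ]

theorem isMonotoneRV_monotoneMap (hν : Integrable id ν) :
    IsMonotoneRV μ (monotoneMap μ ν) := by
  obtain ⟨hmono, hmeas, hmap⟩ := monotoneMap_spec μ ν
  refine ⟨?_, hmono⟩
  rw [← hmap] at hν
  exact (integrable_map_measure hν.aestronglyMeasurable hmeas).1 hν

theorem lawProfile_monotoneMap (a b : ℝ) :
    lawProfile a b μ (monotoneMap μ ν) = lawProfile a b ν id := by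
  funext x
  rw [lawProfile, lawProfile, (monotoneMap_spec μ ν).2.2, Measure.map_id]

end Density

/-! ### Convexity of the overlap and its equality case -/

section Convexity

theorem max_interp_le {t : ℝ} (ht0 : 0 < t) (ht1 : t < 1) (A₀ A₁ B₀ B₁ : ℝ) :
    max ((1 - t) * A₀ + t * A₁) ((1 - t) * B₀ + t * B₁) ≤
      (1 - t) * max A₀ B₀ + t * max A₁ B₁ := by
  have h1 : 0 ≤ 1 - t := by linarith
  refine max_le ?_ ?_ <;> gcongr <;> simp

/-- Equality requires one of the two arguments to attain the maximum at both endpoints, that is, the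
differences `B - A` must not have opposite strict signs. -/
theorem max_interp_eq_iff {t : ℝ} (ht0 : 0 < t) (ht1 : t < 1) (A₀ A₁ B₀ B₁ : ℝ) :
    max ((1 - t) * A₀ + t * A₁) ((1 - t) * B₀ + t * B₁) =
      (1 - t) * max A₀ B₀ + t * max A₁ B₁ ↔ 0 ≤ (B₀ - A₀) * (B₁ - A₁) := by
  have h1 : 0 < 1 - t := by linarith
  rcases le_total A₀ B₀ with h0 | h0 <;> rcases le_total A₁ B₁ with h2 | h2
  · rw [max_eq_right h0, max_eq_right h2, max_eq_right (by gcongr)]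
    simpa using mul_nonneg (sub_nonneg.2 h0) (sub_nonneg.2 h2)
  · rw [max_eq_right h0, max_eq_left h2]
    constructor
    · intro h
      rcases max_choice ((1 - t) * A₀ + t * A₁) ((1 - t) * B₀ + t * B₁) with h3 | h3
      · rw [h3] at h
        have : (1 - t) * (B₀ - A₀) = 0 := by linarith
        rcases mul_eq_zero.1 this with h4 | h4
        · linarith
        · rw [h4, zero_mul]
      · rw [h3] at h
        have : t * (B₁ - A₁) = 0 := by linarith
        rcases mul_eq_zero.1 this with h4 | h4
        · linarith
        · rw [h4, mul_zero]
    · intro h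
      rcases eq_or_lt_of_le h0 with h4 | h4
      · subst h4; rw [max_eq_left]; gcongr
      · have : B₁ = A₁ := by
          have := nonneg_of_mul_nonneg_right h (sub_pos.2 h4)
          linarith
        subst this; rw [max_eq_right]; gcongr
  · rw [max_eq_left h0, max_eq_right h2]
    constructor
    · intro h
      rcases max_choice ((1 - t) * A₀ + t * A₁) ((1 - t) * B₀ + t * B₁) with h3 | h3
      · rw [h3] at h
        have : t * (B₁ - A₁) = 0 := by linarith
        rcases mul_eq_zero.1 this with h4 | h4
        · linarith
        · rw [h4, mul_zero]
      · rw [h3] at h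
        have : (1 - t) * (B₀ - A₀) = 0 := by linarith
        rcases mul_eq_zero.1 this with h4 | h4
        · linarith
        · rw [h4, zero_mul]
    · intro h
      rcases eq_or_lt_of_le h2 with h4 | h4
      · subst h4; rw [max_eq_left]; gcongr
      · have : B₀ = A₀ := by
          have := nonneg_of_mul_nonneg_left h (sub_pos.2 h4)
          linarith
        subst this; rw [max_eq_right]; gcongr
  · rw [max_eq_left h0, max_eq_left h2, max_eq_left (by gcongr)]
    simpa using mul_nonneg_of_nonpos_of_nonpos (sub_nonpos.2 h0) (sub_nonpos.2 h2)

variable {J X Y : ℝ → ℝ} {t : ℝ}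

theorem overlap_interp_le (hJ : ∀ x, 0 ≤ J x) (ht0 : 0 < t) (ht1 : t < 1) (w : ℝ × ℝ × ℝ) :
    overlap J (fun x => (1 - t) * x + t * X x) (fun x => (1 - t) * x + t * Y x) w ≤
      (1 - t) * overlap J id id w + t * overlap J X Y w := by
  have h := mul_le_mul_of_nonneg_left
    (max_interp_le ht0 ht1 w.2.1 (X w.2.1) (w.2.2 + w.1) (Y w.2.2 + w.1)) (hJ w.1)
  simp only [overlap, id]
  rw [show (1 - t) * w.2.2 + t * Y w.2.2 + w.1 =
    (1 - t) * (w.2.2 + w.1) + t * (Y w.2.2 + w.1) by ring]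
  linarith

theorem overlap_interp_eq_iff (ht0 : 0 < t) (ht1 : t < 1) (w : ℝ × ℝ × ℝ) :
    overlap J (fun x => (1 - t) * x + t * X x) (fun x => (1 - t) * x + t * Y x) w =
      (1 - t) * overlap J id id w + t * overlap J X Y w ↔
    J w.1 = 0 ∨ 0 ≤ (w.2.2 + w.1 - w.2.1) * (Y w.2.2 + w.1 - X w.2.1) := by
  rw [← max_interp_eq_iff ht0 ht1]
  simp only [overlap, id]
  rw [show (1 - t) * w.2.2 + t * Y w.2.2 + w.1 =
    (1 - t) * (w.2.2 + w.1) + t * (Y w.2.2 + w.1) by ring]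
  constructor
  · intro h
    refine or_iff_not_imp_left.2 fun hJ => mul_left_cancel₀ hJ ?_
    linarith
  · rintro (h | h)
    · simp [h]
    · rw [h]; ring

end Convexity

section Interpolation

variable {μ : Measure ℝ} {X k : ℝ → ℝ}

theorem integral_interp (h0 : Integrable id μ) (hX : Integrable X μ) (t : ℝ) :
    ∫ u, ((1 - t) * u + t * X u) ∂μ = (1 - t) * ∫ u, id u ∂μ + t * ∫ u, X u ∂μ := by
  rw [← integral_const_mul, ← integral_const_mul,
    ← integral_add (h0.const_mul (1 - t)) (hX.const_mul t)]
  rfl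

theorem integral_interp_mul (h0 : Integrable (fun u => k u * id u) μ)
    (hX : Integrable (fun u => k u * X u) μ) (t : ℝ) :
    ∫ u, k u * ((1 - t) * u + t * X u) ∂μ =
      (1 - t) * ∫ u, k u * id u ∂μ + t * ∫ u, k u * X u ∂μ := by
  rw [← integral_const_mul, ← integral_const_mul,
    ← integral_add (h0.const_mul (1 - t)) (hX.const_mul t)]
  exact integral_congr_ae (.of_forall fun u => by simp only [id]; ring)

end Interpolation

/-! ### Rigidity: equality forces a common translation -/

section Rigidity

theorem exists_mem_Ioo_of_ae {p : ℝ → Prop} (h : ∀ᵐ x, p x) {l r : ℝ} (hlr : l < r) :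
    ∃ x ∈ Ioo l r, p x := by
  obtain ⟨x, hx, hx'⟩ := (Measure.dense_of_ae h).exists_between hlr
  exact ⟨x, hx', hx⟩

theorem eq_of_locally_eq_on_dense {S : Set ℝ} (hS : Dense S) {g : ℝ → ℝ} {δ : ℝ} (hδ : 0 < δ)
    (h : ∀ x ∈ S, ∀ y ∈ S, x ≤ y → y - x < δ → g x = g y) {x y : ℝ} (hx : x ∈ S) (hy : y ∈ S) :
    g x = g y := by
  have key : ∀ n : ℕ, ∀ x ∈ S, ∀ y ∈ S, x ≤ y → y - x < (n + 1) * (δ / 2) → g x = g y := by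
    intro n
    induction n with
    | zero =>
      intro x hx y hy hxy hlt
      exact h x hx y hy hxy (by norm_num at hlt; linarith)
    | succ n ih =>
      intro x hx y hy hxy hlt
      rcases lt_or_ge (y - x) δ with h1 | h1
      · exact h x hx y hy hxy h1
      -- The jump from `z` to `y` is shorter than `δ`, so the local hypothesis applies, and longer
      -- than `δ / 2`, so the induction gains one unit.
      obtain ⟨z, hz, hz'⟩ := hS.exists_between (show y - δ < y - δ / 2 by linarith)
      push_cast at hlt
      rw [ih x hx z hz (by linarith [hz'.1]) (by linarith [hz'.2])]
      exact h z hz y hy (by linarith [hz'.2]) (by linarith [hz'.1])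
  have key' : ∀ x ∈ S, ∀ y ∈ S, x ≤ y → g x = g y := fun x hx y hy hxy => by
    obtain ⟨n, hn⟩ := exists_nat_gt ((y - x) / (δ / 2))
    refine key n x hx y hy hxy ?_
    rw [div_lt_iff₀ (by positivity)] at hn
    linarith
  rcases le_total x y with hxy | hxy
  · exact key' x hx y hy hxy
  · exact (key' y hy x hx hxy).symm

/-- Two values `x, y` of the second coordinate closer than `d - c` have overlapping slices of the
strip. A common generic `p` gives `g x = f p = g y`, so `g` is locally constant on a dense set of
full measure, hence constant there; `f` takes the same value. -/
theorem exists_ae_eq_const_of_strip {f g : ℝ → ℝ} {c d : ℝ} (hcd : c < d)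
    (h : ∀ᵐ z : ℝ × ℝ, z.1 - z.2 ∈ Ioo c d → f z.1 = g z.2) :
    ∃ r, (∀ᵐ x, f x = r) ∧ ∀ᵐ x, g x = r := by
  have h1 : ∀ᵐ p : ℝ, ∀ᵐ q : ℝ, p - q ∈ Ioo c d → f p = g q := Measure.ae_ae_of_ae_prod h
  have h2 : ∀ᵐ q : ℝ, ∀ᵐ p : ℝ, p - q ∈ Ioo c d → f p = g q :=
    Measure.ae_ae_of_ae_prod (Measure.measurePreserving_swap.quasiMeasurePreserving.ae h)
  have hdense := Measure.dense_of_ae h2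
  have hloc : ∀ x ∈ {q | ∀ᵐ p : ℝ, p - q ∈ Ioo c d → f p = g q},
      ∀ y ∈ {q | ∀ᵐ p : ℝ, p - q ∈ Ioo c d → f p = g q}, x ≤ y → y - x < d - c →
      g x = g y := by
    intro x hx y hy hxy hlt
    rw [mem_ofPred_eq] at hx hy
    obtain ⟨p, hp, hpx, hpy⟩ := exists_mem_Ioo_of_ae (hx.and hy) (show y + c < x + d by linarith)
    rw [← hpx ⟨by linarith [hp.1], by linarith [hp.2]⟩,
      ← hpy ⟨by linarith [hp.1], by linarith [hp.2]⟩]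
  obtain ⟨y₀, hy₀⟩ := hdense.nonempty
  have hg : ∀ᵐ x, g x = g y₀ := by
    filter_upwards [h2] with x hx
    exact eq_of_locally_eq_on_dense hdense (sub_pos.2 hcd) hloc hx hy₀
  refine ⟨g y₀, ?_, hg⟩
  filter_upwards [h1] with p hp
  obtain ⟨q, hq, hpq, hgq⟩ := exists_mem_Ioo_of_ae (hp.and hg) (show p - d < p - c by linarith)
  rw [hpq ⟨by linarith [hq.2], by linarith [hq.1]⟩, hgq]

theorem exists_translation {J X Y : ℝ → ℝ} {c d : ℝ} (hcd : c < d)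
    (hJ : ∀ x ∈ Ioo c d, 0 < J x)
    (h : ∀ᵐ w : ℝ × ℝ × ℝ, J w.1 = 0 ∨
      0 ≤ (w.2.2 + w.1 - w.2.1) * (Y w.2.2 + w.1 - X w.2.1)) :
    ∃ r, (∀ᵐ x, X x = x + r) ∧ ∀ᵐ x, Y x = x + r := by
  have h1 : ∀ᵐ z : ℝ × ℝ, ∀ᵐ u : ℝ, J u = 0 ∨
      0 ≤ (z.2 + u - z.1) * (Y z.2 + u - X z.1) :=
    Measure.ae_ae_of_ae_prod (Measure.measurePreserving_swap.quasiMeasurePreserving.ae h)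
  have h2 : ∀ᵐ z : ℝ × ℝ, z.1 - z.2 ∈ Ioo c d → X z.1 - z.1 = Y z.2 - z.2 := by
    filter_upwards [h1] with z hz hzc
    by_contra hne
    rcases lt_or_gt_of_ne hne with hlt | hlt
    -- The two factors vanish at `u = p - q` and at `u = X p - Y q`. If these differ, the product is
    -- negative between them, and since `p - q` is interior to `(c, d)`, part of that gap lies where
    -- `J > 0`.
    · obtain ⟨u, hu, hu'⟩ := exists_mem_Ioo_of_ae hz
        (show max c (X z.1 - Y z.2) < z.1 - z.2 from max_lt hzc.1 (by linarith))
      have hc := (max_lt_iff.1 hu.1)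
      rcases hu' with h0 | h0
      · exact (hJ u ⟨hc.1, hu.2.trans hzc.2⟩).ne' h0
      · exact absurd h0 (not_le.2 (mul_neg_of_neg_of_pos (by linarith [hu.2]) (by linarith [hc.2])))
    · obtain ⟨u, hu, hu'⟩ := exists_mem_Ioo_of_ae hz
        (show z.1 - z.2 < min d (X z.1 - Y z.2) from lt_min hzc.2 (by linarith))
      have hc := (lt_min_iff.1 hu.2)
      rcases hu' with h0 | h0
      · exact (hJ u ⟨hzc.1.trans hu.1, hc.1⟩).ne' h0
      · exact absurd h0 (not_le.2 (mul_neg_of_pos_of_neg (by linarith [hu.1]) (by linarith [hc.2])))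
  obtain ⟨r, hr1, hr2⟩ := exists_ae_eq_const_of_strip (f := fun p => X p - p)
    (g := fun q => Y q - q) hcd h2
  refine ⟨r, ?_, ?_⟩
  · filter_upwards [hr1] with x hx
    linarith
  · filter_upwards [hr2] with x hx
    linarith

end Rigidity

end BinaryFluid

/-! ### Displacement convexity and the equality case -/

theorem mainTheorem2
    -- the interaction kernel
    (J : ℝ → ℝ) (hJ_nonneg : ∀ x, 0 ≤ J x) (hJ_even : ∀ x, J (-x) = J x)
    (hJ_supp : HasCompactSupport J) (hJ_int : Integrable J)
    -- the inverse temperature, the chemical potential and the two coexisting densities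
    (β lam ρm ρp : ℝ) (hβ : 0 < β) (hρm : 0 ≤ ρm) (hρ : ρm < ρp)
    (hmin₁ : IsMinOn (localGibbs J β lam) quadrant (ρm, ρp))
    (hmin₂ : IsMinOn (localGibbs J β lam) quadrant (ρp, ρm))
    -- the two pairs of profiles and their densities
    (w₁ w₂ v₁ v₂ η₁ η₂ ζ₁ ζ₂ : ℝ → ℝ)
    (hw : (w₁, w₂) ∈ incProfiles ρm ρp ×ˢ decProfiles ρp ρm)
    (hv : (v₁, v₂) ∈ incProfiles ρm ρp ×ˢ decProfiles ρp ρm)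
    (hw₁ : HasDensity ρm ρp w₁ η₁) (hw₂ : HasDensity ρp ρm w₂ η₂)
    (hv₁ : HasDensity ρm ρp v₁ ζ₁) (hv₂ : HasDensity ρp ρm v₂ ζ₂)
    (hη₁ : FiniteFirstMoment η₁) (hη₂ : FiniteFirstMoment η₂)
    (hζ₁ : FiniteFirstMoment ζ₁) (hζ₂ : FiniteFirstMoment ζ₂) :
    -- the excess free energy is well defined along the interpolation
    Integrable (excessDensity J β lam w₁ w₂) ∧
    Integrable (excessDensity J β lam v₁ v₂) ∧
    ∀ t : ℝ, 0 < t → t < 1 →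
      Integrable (excessDensity J β lam
        (interpProfile ρm ρp η₁ ζ₁ t) (interpProfile ρp ρm η₂ ζ₂ t)) ∧
      excessEnergy J β lam (interpProfile ρm ρp η₁ ζ₁ t) (interpProfile ρp ρm η₂ ζ₂ t)
        ≤ (1 - t) * excessEnergy J β lam w₁ w₂ + t * excessEnergy J β lam v₁ v₂ ∧
      ((∃ c d : ℝ, c < d ∧ ∀ x ∈ Ioo c d, 0 < J x) →
        (∀ᵐ x, 0 < deriv w₁ x) → (∀ᵐ x, deriv w₂ x < 0) →
        (excessEnergy J β lam (interpProfile ρm ρp η₁ ζ₁ t) (interpProfile ρp ρm η₂ ζ₂ t)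
            = (1 - t) * excessEnergy J β lam w₁ w₂ + t * excessEnergy J β lam v₁ v₂ ↔
          ∃ a : ℝ, ∀ x, v₁ x = w₁ (x - a) ∧ v₂ x = w₂ (x - a))) := by
  have ha : 0 < ρm := pos_of_isMinOn hρm (hρm.trans hρ.le) hmin₁
  have hg := minGibbs_eq hρm (hρm.trans hρ.le) hmin₁
  have := isProbabilityMeasure_densityMeasure hw₁.isProbDensity
  have := isProbabilityMeasure_densityMeasure hw₂.isProbDensity
  have := isProbabilityMeasure_densityMeasure hv₁.isProbDensity
  have := isProbabilityMeasure_densityMeasure hv₂.isProbDensity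
  have := nullSingletonClass_densityMeasure η₁
  have := nullSingletonClass_densityMeasure η₂
  have ew₁ := hw₁.eq_lawProfile
  have ew₂ := hw₂.eq_lawProfile
  have ev₁ := hv₁.eq_lawProfile
  have ev₂ := hv₂.eq_lawProfile
  have iη₁ := integrable_id_densityMeasure hw₁.isProbDensity hη₁
  have iη₂ := integrable_id_densityMeasure hw₂.isProbDensity hη₂
  have iζ₁ := integrable_id_densityMeasure hv₁.isProbDensity hζ₁
  have iζ₂ := integrable_id_densityMeasure hv₂.isProbDensity hζ₂
  set μ₁ := densityMeasure η₁ with hμ₁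
  set μ₂ := densityMeasure η₂ with hμ₂
  set ν₁ := densityMeasure ζ₁ with hν₁
  set ν₂ := densityMeasure ζ₂ with hν₂
  set T₁ := monotoneMap μ₁ ν₁ with hT₁
  set T₂ := monotoneMap μ₂ ν₂ with hT₂
  have mT₁ : IsMonotoneRV μ₁ T₁ := isMonotoneRV_monotoneMap iζ₁
  have mT₂ : IsMonotoneRV μ₂ T₂ := isMonotoneRV_monotoneMap iζ₂
  have eT₁ : lawProfile ρm ρp μ₁ T₁ = v₁ := by rw [ev₁]; exact lawProfile_monotoneMap _ _
  have eT₂ : lawProfile ρp ρm μ₂ T₂ = v₂ := by rw [ev₂]; exact lawProfile_monotoneMap _ _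
  obtain ⟨a0, b0, c0, d0⟩ := excessEnergy_formula (β := β) hJ_supp hJ_int ha hρ hg
    (isMonotoneRV_id iη₁) (isMonotoneRV_id iη₂)
  obtain ⟨a1, b1, c1, d1⟩ := excessEnergy_formula (β := β) hJ_supp hJ_int ha hρ hg mT₁ mT₂
  rw [← ew₁, ← ew₂] at c0 d0
  rw [eT₁, eT₂] at c1 d1
  refine ⟨c0, c1, fun t ht0 ht1 => ?_⟩
  have mI₁ := mT₁.interp iη₁ ht0.le ht1.le
  have mI₂ := mT₂.interp iη₂ ht0.le ht1.le
  obtain ⟨-, -, ct, dt⟩ := excessEnergy_formula (β := β) hJ_supp hJ_int ha hρ hg mI₁ mI₂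
  -- `interpProfile` is by definition the law profile of `(1 - t) id + t T`.
  change Integrable (excessDensity J β lam (interpProfile ρm ρp η₁ ζ₁ t)
    (interpProfile ρp ρm η₂ ζ₂ t)) at ct
  change excessEnergy J β lam (interpProfile ρm ρp η₁ ζ₁ t)
    (interpProfile ρp ρm η₂ ζ₂ t) = _ at dt
  have o0 := integrable_overlap hJ_supp hJ_int iη₁ iη₂
  have o1 := integrable_overlap hJ_supp hJ_int mT₁.integrable mT₂.integrable
  have ot := integrable_overlap hJ_supp hJ_int mI₁.integrable mI₂.integrable
  set κ := (volume : Measure ℝ).prod (μ₁.prod μ₂) with hκ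
  -- `D` is the pointwise convexity defect of the overlap. The affine terms of the energy formula
  -- cancel, so a positive multiple of `∫ D` is the whole gap in the inequality.
  set D : ℝ × ℝ × ℝ → ℝ := fun w => (1 - t) * overlap J id id w + t * overlap J T₁ T₂ w -
    overlap J (fun x => (1 - t) * x + t * T₁ x) (fun x => (1 - t) * x + t * T₂ x) w with hD
  have hDnn : 0 ≤ D := fun w => sub_nonneg.2 (overlap_interp_le hJ_nonneg ht0 ht1 w)
  have hDi' : Integrable (fun w => (1 - t) * overlap J id id w + t * overlap J T₁ T₂ w) κ :=
    (o0.const_mul _).add (o1.const_mul _)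
  have hDi : Integrable D κ := hDi'.sub ot
  have hDint : ∫ w, D w ∂κ = (1 - t) * ∫ w, overlap J id id w ∂κ +
      t * ∫ w, overlap J T₁ T₂ w ∂κ - ∫ w, overlap J (fun x => (1 - t) * x + t * T₁ x)
        (fun x => (1 - t) * x + t * T₂ x) w ∂κ := by
    rw [hD, integral_sub hDi' ot, integral_add (o0.const_mul _) (o1.const_mul _),
      integral_const_mul, integral_const_mul]
  have key : excessEnergy J β lam (interpProfile ρm ρp η₁ ζ₁ t) (interpProfile ρp ρm η₂ ζ₂ t) =
      (1 - t) * excessEnergy J β lam w₁ w₂ + t * excessEnergy J β lam v₁ v₂ -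
        β * (ρp - ρm) ^ 2 * ∫ w, D w ∂κ := by
    rw [dt, d0, d1, hDint]
    rw [integral_interp_mul a0 a1, integral_interp_mul b0 b1,
      integral_interp iη₁ mT₁.integrable, integral_interp iη₂ mT₂.integrable]
    ring
  have hpos : 0 < β * (ρp - ρm) ^ 2 := mul_pos hβ (pow_pos (sub_pos.2 hρ) 2)
  refine ⟨ct, ?_, ?_⟩
  · have := mul_nonneg hpos.le (integral_nonneg (μ := κ) hDnn)
    linarith
  rintro ⟨c, d, hcd, hJcd⟩ hw₁' hw₂'
  have ac₁ : (volume : Measure ℝ) ≪ μ₁ :=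
    volume_absolutelyContinuous_densityMeasure hw₁ (hw₁'.mono fun x hx => hx.ne')
  have ac₂ : (volume : Measure ℝ) ≪ μ₂ :=
    volume_absolutelyContinuous_densityMeasure hw₂ (hw₂'.mono fun x hx => hx.ne)
  have hiff : excessEnergy J β lam (interpProfile ρm ρp η₁ ζ₁ t)
      (interpProfile ρp ρm η₂ ζ₂ t) =
      (1 - t) * excessEnergy J β lam w₁ w₂ + t * excessEnergy J β lam v₁ v₂ ↔ D =ᵐ[κ] 0 := by
    rw [← integral_eq_zero_iff_of_nonneg hDnn hDi, key, sub_eq_self, mul_eq_zero]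
    exact or_iff_right hpos.ne'
  rw [hiff]
  constructor
  · intro h
    -- The rigidity argument needs Lebesgue-generic points; positivity of the densities of `μ₁` and
    -- `μ₂` transfers the vanishing of `D` from `κ` to Lebesgue measure.
    have hκac : (volume : Measure (ℝ × ℝ × ℝ)) ≪ κ :=
      Measure.AbsolutelyContinuous.rfl.prod (ac₁.prod ac₂)
    have h' : ∀ᵐ w : ℝ × ℝ × ℝ, J w.1 = 0 ∨
        0 ≤ (w.2.2 + w.1 - w.2.1) * (T₂ w.2.2 + w.1 - T₁ w.2.1) := by
      filter_upwards [hκac.ae_le h] with w hw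
      exact (overlap_interp_eq_iff ht0 ht1 w).1 (sub_eq_zero.1 hw).symm
    obtain ⟨r, hr₁, hr₂⟩ := exists_translation hcd hJcd h'
    have hr₁' : ∀ᵐ x ∂μ₁, T₁ x = x + r := withDensity_absolutelyContinuous _ _ hr₁
    have hr₂' : ∀ᵐ x ∂μ₂, T₂ x = x + r := withDensity_absolutelyContinuous _ _ hr₂
    refine ⟨r, fun x => ⟨?_, ?_⟩⟩
    · rw [← eT₁, ew₁]; exact lawProfile_translate hr₁' _ _ x
    · rw [← eT₂, ew₂]; exact lawProfile_translate hr₂' _ _ x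
  · rintro ⟨r, hr⟩
    have hr₁ : ∀ x, T₁ x = x + r := monotoneMap_translate ac₁ hρ.ne
      (fun x => by rw [← ev₁, ← ew₁]; exact (hr x).1)
    have hr₂ : ∀ x, T₂ x = x + r := monotoneMap_translate ac₂ hρ.ne'
      (fun x => by rw [← ev₂, ← ew₂]; exact (hr x).2)
    -- A common shift `r` cancels in the difference of positions, so the sign condition becomes that
    -- a square is nonnegative.
    refine .of_forall fun w => sub_eq_zero.2 (Eq.symm ?_)
    refine (overlap_interp_eq_iff ht0 ht1 w).2 (Or.inr ?_)
    rw [hr₁, hr₂]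
    have : w.2.2 + r + w.1 - (w.2.1 + r) = w.2.2 + w.1 - w.2.1 := by ring
    rw [this]
    exact mul_self_nonneg _
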